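/- **Conventions.** A *Brouwerian algebra* is an algebra $\mathbf{A}=(A,\wedge,\vee,\to,t)$ such that $(A,\wedge,\vee)$ is a lattice with greatest element $t$ and $a\wedge b\le c\iff a\le b\to c$ for all $a,b,c\in A$; a *Heyting algebra* is a Brouwerian algebra with an additional constant $\bot$ denoting a least element. Semilinear Brouwerian algebras (i.e. subdirect products of totally ordered Brouwerian algebras) are called *relative Stone algebras*, and semilinear Heyting algebras (i.e. subdirect products of totally ordered Heyting algebras) are called *Gödel algebras*. A *bRS-algebra* (relative Stone algebra with Boolean constant) is a relative Stone algebra with an additional constant $f$ satisfying $a\vee(a\to f)=t$ for all $a$; a *bG-algebra* is a Gödel algebra with an additional constant $f$ satisfying the same identity. Let $\mathsf{bRSA}$ and $\mathsf{bGA}$ be the categories of bRS-algebras and of bG-algebras, with all algebra homomorphisms (preserving all operations and constants) as morphisms. A *Priestley space* is a poset $X$ with a compact topology such that whenever $x\not\le y$ there is a clopen up-set containing $x$ but not $y$; it is an *Esakia space* if moreover the down-set generated by any clopen set is clopen. An *Esakia map* is a continuous order-preserving map $\varphi\colon X\to Y$ such that $\varphi(x)\le z$ implies $\varphi(y)=z$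 for some $y\ge x$. A poset is a *forest* if every principal up-set ${\uparrow}x=\{y: x\le y\}$ is a chain. A *bG-space* is a structure $(X,\le,D,\tau)$ such that $(X,\le,\tau)$ is an Esakia space, $(X,\le)$ is a forest, and $D\subseteq X$ is a clopen set of minimal elements. A *bRS-space* is a structure $(X,\le,D,\top,\tau)$ such that $(X,\le,D,\tau)$ is a bG-space, $\top$ is the greatest element of $X$, and $\top\notin D$. Let $\mathsf{bGS}$ be the category of bG-spaces whose morphisms $X\to Y$ are the Esakia maps $\varphi$ with $\varphi[D_X]\subseteq D_Y$ and $\varphi[X\setminus D_X]\subseteq Y\setminus D_Y$, and $\mathsf{bRSS}$ the category of bRS-spaces whose morphisms are such maps that in addition satisfy $\varphi(\top_X)=\top_Y$. **Theorem.** (1) $\mathsf{bRSA}$ and $\mathsf{bRSS}$ are dually equivalent. The equivalence is witnessed (up to natural isomorphism) by the following contravariant functors. For a bRS-algebra $\mathbf{A}$, $\mathbf{A}_*$ is the set of generalized prime filters of $\mathbf{A}$ (prime filters, together with $A$ itself), ordered by inclusion, with the topology generated by the sets $\sigma(a)=\{x : a\in x\}$ ($a\in A$) and their complements, and with designated set the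 complement of $\sigma(f)$; for a homomorphism $h$, $h_*(y)=h^{-1}[y]$. For a bRS-space $X$, $X^*$ is the algebra of nonempty clopen up-sets of $X$, ordered by inclusion, with $U\to V=\{x : {\uparrow}x\cap U\subseteq V\}$ and with constant $f=X\setminus D$; for a morphism $\varphi$, $\varphi^*(U)=\varphi^{-1}[U]$. (2) $\mathsf{bGA}$ and $\mathsf{bGS}$ are dually equivalent, witnessed (up to natural isomorphism) by the functors defined in the same way, with prime filters in place of generalized prime filters and with all clopen up-sets in place of the nonempty ones. -/

import Mathlib

open CategoryTheory Opposite

universe u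

/-! ## Algebras

A Brouwerian algebra `(A, ∧, ∨, →, t)` is a `GeneralizedHeytingAlgebra` (with `t = ⊤`), and a
Heyting algebra is a `HeytingAlgebra`. -/

/-- Homomorphisms of Brouwerian algebras: maps preserving `∧`, `∨`, `→`, `t`. -/
structure BrouwerianHom (A B : Type*) [GeneralizedHeytingAlgebra A] [GeneralizedHeytingAlgebra B]
    extends LatticeHom A B where
  map_himp' : ∀ a b, toFun (a ⇨ b) = toFun a ⇨ toFun b
  map_top' : toFun ⊤ = ⊤

/-- A Brouwerian algebra is semilinear if it is a subdirect product of totally ordered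
Brouwerian algebras: there is a jointly injective family of surjective homomorphisms onto totally
ordered Brouwerian algebras. A semilinear Brouwerian algebra is a relative Stone algebra. -/
def IsRelativeStone (A : Type u) [GeneralizedHeytingAlgebra A] : Prop :=
  ∃ (ι : Type u) (C : ι → Type u) (_ : ∀ i, GeneralizedHeytingAlgebra (C i))
    (p : ∀ i, BrouwerianHom A (C i)),
    (∀ i, ∀ c d : C i, c ≤ d ∨ d ≤ c) ∧
    (∀ i, Function.Surjective (p i).toFun) ∧
    (∀ a b : A, (∀ i, (p i).toFun a = (p i).toFun b) → a = b)

/-- A Heyting algebra is semilinear (a Gödel algebra) if it is a subdirect product of totally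
ordered Heyting algebras. -/
def IsGoedel (A : Type u) [HeytingAlgebra A] : Prop :=
  ∃ (ι : Type u) (C : ι → Type u) (_ : ∀ i, HeytingAlgebra (C i))
    (p : ∀ i, HeytingHom A (C i)),
    (∀ i, ∀ c d : C i, c ≤ d ∨ d ≤ c) ∧
    (∀ i, Function.Surjective (p i)) ∧
    (∀ a b : A, (∀ i, p i a = p i b) → a = b)

/-- Relative Stone algebras with Boolean constant `f`. -/
structure BRSAlg : Type (u + 1) where
  carrier : Type u
  [str : GeneralizedHeytingAlgebra carrier]
  semilinear : IsRelativeStone carrier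
  f : carrier
  sup_himp_f : ∀ a : carrier, a ⊔ (a ⇨ f) = ⊤

namespace BRSAlg

instance : CoeSort BRSAlg.{u} (Type u) := ⟨BRSAlg.carrier⟩

attribute [instance] BRSAlg.str

/-- Homomorphisms in the language `(∧, ∨, →, t, f)`. -/
@[ext]
structure Hom (A B : BRSAlg.{u}) where
  toHom : BrouwerianHom A B
  map_f : toHom.toFun A.f = B.f

instance : Category BRSAlg.{u} where
  Hom := Hom
  id A := ⟨⟨LatticeHom.id A, fun _ _ => rfl, rfl⟩, rfl⟩
  comp {A B C} g h :=
    { toHom :=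
        { toLatticeHom := h.toHom.toLatticeHom.comp g.toHom.toLatticeHom
          map_himp' := fun a b => by
            have h1 := g.toHom.map_himp' a b
            have h2 := h.toHom.map_himp' (g.toHom.toFun a) (g.toHom.toFun b)
            exact (congrArg h.toHom.toFun h1).trans h2
          map_top' := (congrArg h.toHom.toFun g.toHom.map_top').trans h.toHom.map_top' }
      map_f := (congrArg h.toHom.toFun g.map_f).trans h.map_f }

/-- The underlying map of a morphism. -/
def map {A B : BRSAlg.{u}} (h : A ⟶ B) : A → B := (show Hom A B from h).toHom.toFun

end BRSAlg

/-- bG-algebras: Gödel algebras with Boolean constant `f`. -/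
structure BGAlg : Type (u + 1) where
  carrier : Type u
  [str : HeytingAlgebra carrier]
  semilinear : IsGoedel carrier
  f : carrier
  sup_himp_f : ∀ a : carrier, a ⊔ (a ⇨ f) = ⊤

namespace BGAlg

instance : CoeSort BGAlg.{u} (Type u) := ⟨BGAlg.carrier⟩

attribute [instance] BGAlg.str

/-- Homomorphisms in the language `(∧, ∨, →, t, ⊥, f)`. -/
@[ext]
structure Hom (A B : BGAlg.{u}) where
  toHom : HeytingHom A B
  map_f : toHom A.f = B.f

instance : Category BGAlg.{u} where
  Hom := Hom
  id A := ⟨HeytingHom.id A, rfl⟩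
  comp g h := ⟨h.toHom.comp g.toHom, (congrArg h.toHom g.map_f).trans h.map_f⟩

/-- The underlying map of a morphism. -/
def map {A B : BGAlg.{u}} (h : A ⟶ B) : A → B := (show Hom A B from h).toHom

end BGAlg

/-! ## Spaces -/

/-- Esakia spaces: compact Priestley spaces in which the down-set of a clopen set is clopen. -/
structure IsEsakiaSpace (X : Type*) [PartialOrder X] [TopologicalSpace X] : Prop where
  compact : CompactSpace X
  priestley : PriestleySpace X
  isClopen_down : ∀ U : Set X, IsClopen U → IsClopen {x | ∃ y ∈ U, x ≤ y}

/-- A poset is a forest if every principal up-set is a chain. -/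
def IsForest (X : Type*) [PartialOrder X] : Prop :=
  ∀ x : X, IsChain (· ≤ ·) (Set.Ici x)

/-- bRS-spaces. The greatest element does not belong to `D`; since `D` consists of minimal
elements, this only rules out the one-point space with `D` equal to the whole space. -/
structure BRSSpace : Type (u + 1) where
  carrier : Type u
  [order : PartialOrder carrier]
  [orderTop : OrderTop carrier]
  [topology : TopologicalSpace carrier]
  isEsakia : IsEsakiaSpace carrier
  isForest : IsForest carrier
  D : Set carrier
  isClopen_D : IsClopen D
  isMin_of_mem_D : ∀ x ∈ D, IsMin x
  top_notMem_D : ⊤ ∉ D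

namespace BRSSpace

instance : CoeSort BRSSpace.{u} (Type u) := ⟨BRSSpace.carrier⟩

attribute [instance] BRSSpace.order BRSSpace.orderTop BRSSpace.topology

/-- Pointed Esakia maps `φ` with `φ[D] ⊆ D` and `φ[Dᶜ] ⊆ Dᶜ`. -/
@[ext]
structure Hom (X Y : BRSSpace.{u}) where
  toHom : EsakiaHom X Y
  map_top : toHom ⊤ = ⊤
  image_D : toHom '' X.D ⊆ Y.D
  image_D_compl : toHom '' X.Dᶜ ⊆ Y.Dᶜ

instance : Category BRSSpace.{u} where
  Hom := Hom
  id X := ⟨EsakiaHom.id X, rfl, by simp, by simp⟩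
  comp g h :=
    { toHom := h.toHom.comp g.toHom
      map_top := (congrArg h.toHom g.map_top).trans h.map_top
      image_D := by
        rintro _ ⟨x, hx, rfl⟩
        exact h.image_D ⟨_, g.image_D ⟨x, hx, rfl⟩, rfl⟩
      image_D_compl := by
        rintro _ ⟨x, hx, rfl⟩
        exact h.image_D_compl ⟨_, g.image_D_compl ⟨x, hx, rfl⟩, rfl⟩ }

/-- The underlying map of a morphism. -/
def map {X Y : BRSSpace.{u}} (φ : X ⟶ Y) : X → Y := (show Hom X Y from φ).toHom

end BRSSpace

/-- bG-spaces. -/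
structure BGSpace : Type (u + 1) where
  carrier : Type u
  [order : PartialOrder carrier]
  [topology : TopologicalSpace carrier]
  isEsakia : IsEsakiaSpace carrier
  isForest : IsForest carrier
  D : Set carrier
  isClopen_D : IsClopen D
  isMin_of_mem_D : ∀ x ∈ D, IsMin x

namespace BGSpace

instance : CoeSort BGSpace.{u} (Type u) := ⟨BGSpace.carrier⟩

attribute [instance] BGSpace.order BGSpace.topology

/-- Esakia maps `φ` with `φ[D] ⊆ D` and `φ[Dᶜ] ⊆ Dᶜ`. -/
@[ext]
structure Hom (X Y : BGSpace.{u}) where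
  toHom : EsakiaHom X Y
  image_D : toHom '' X.D ⊆ Y.D
  image_D_compl : toHom '' X.Dᶜ ⊆ Y.Dᶜ

instance : Category BGSpace.{u} where
  Hom := Hom
  id X := ⟨EsakiaHom.id X, by simp, by simp⟩
  comp g h :=
    { toHom := h.toHom.comp g.toHom
      image_D := by
        rintro _ ⟨x, hx, rfl⟩
        exact h.image_D ⟨_, g.image_D ⟨x, hx, rfl⟩, rfl⟩
      image_D_compl := by
        rintro _ ⟨x, hx, rfl⟩
        exact h.image_D_compl ⟨_, g.image_D_compl ⟨x, hx, rfl⟩, rfl⟩ }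

/-- The underlying map of a morphism. -/
def map {X Y : BGSpace.{u}} (φ : X ⟶ Y) : X → Y := (show Hom X Y from φ).toHom

end BGSpace

/-! ## The dual space of an algebra -/

/-- Prime filters of a lattice (proper and nonempty). -/
def PrimeFilter (A : Type u) [Lattice A] : Type u :=
  {x : Order.PFilter A // x.IsPrime}

/-- Generalized prime filters of a lattice: prime filters together with the whole lattice. -/
def GenPrimeFilter (A : Type u) [Lattice A] : Type u :=
  {x : Order.PFilter A // x.IsPrime ∨ (x : Set A) = Set.univ}

namespace PrimeFilter

variable {A : Type u} [Lattice A]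

/-- Prime filters are ordered by inclusion. -/
instance : PartialOrder (PrimeFilter A) :=
  inferInstanceAs (PartialOrder {x : Order.PFilter A // x.IsPrime})

/-- `σ(a) = {x | a ∈ x}`. -/
def sigma (a : A) : Set (PrimeFilter A) := {x | a ∈ x.1}

/-- The topology with subbase the sets `σ(a)` and their complements. -/
instance : TopologicalSpace (PrimeFilter A) :=
  TopologicalSpace.generateFrom (Set.range sigma ∪ Set.range fun a : A => (sigma a)ᶜ)

end PrimeFilter

namespace GenPrimeFilter

variable {A : Type u} [Lattice A]

/-- Generalized prime filters are ordered by inclusion. -/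
instance : PartialOrder (GenPrimeFilter A) :=
  inferInstanceAs
    (PartialOrder {x : Order.PFilter A // x.IsPrime ∨ (x : Set A) = Set.univ})

/-- `σ(a) = {x | a ∈ x}`. -/
def sigma (a : A) : Set (GenPrimeFilter A) := {x | a ∈ x.1}

/-- The topology with subbase the sets `σ(a)` and their complements. -/
instance : TopologicalSpace (GenPrimeFilter A) :=
  TopologicalSpace.generateFrom (Set.range sigma ∪ Set.range fun a : A => (sigma a)ᶜ)

end GenPrimeFilter

/-- `F` is, up to natural isomorphism, the functor `(-)_*` on bRS-algebras: `F A` is the ordered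
space of generalized prime filters of `A` (an order isomorphism that is a homeomorphism), with
designated set the complement of `σ(f)`, and `F h` is `y ↦ h⁻¹[y]`. -/
def IsDualSpaceFunctorBRS (F : BRSAlg.{u}ᵒᵖ ⥤ BRSSpace.{u}) : Prop :=
  ∃ i : ∀ A : BRSAlg.{u}, F.obj (op A) ≃o GenPrimeFilter A,
    (∀ A, IsHomeomorph (i A)) ∧
    (∀ A, i A '' (F.obj (op A)).D = (GenPrimeFilter.sigma A.f)ᶜ) ∧
    (∀ (A B : BRSAlg.{u}) (h : A ⟶ B) (y : F.obj (op B)),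
      ((i A (BRSSpace.map (F.map h.op) y)).1 : Set A) = BRSAlg.map h ⁻¹' ((i B y).1 : Set B))

/-- `F` is, up to natural isomorphism, the functor `(-)_*` on bG-algebras: `F A` is the ordered
space of prime filters of `A`, with designated set the complement of `σ(f)`, and `F h` is
`y ↦ h⁻¹[y]`. -/
def IsDualSpaceFunctorBG (F : BGAlg.{u}ᵒᵖ ⥤ BGSpace.{u}) : Prop :=
  ∃ i : ∀ A : BGAlg.{u}, F.obj (op A) ≃o PrimeFilter A,
    (∀ A, IsHomeomorph (i A)) ∧
    (∀ A, i A '' (F.obj (op A)).D = (PrimeFilter.sigma A.f)ᶜ) ∧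
    (∀ (A B : BGAlg.{u}) (h : A ⟶ B) (y : F.obj (op B)),
      ((i A (BGSpace.map (F.map h.op) y)).1 : Set A) = BGAlg.map h ⁻¹' ((i B y).1 : Set B))

/-! ## The dual algebra of a space -/

/-- Nonempty clopen up-sets, ordered by inclusion. -/
abbrev NonemptyClopenUpperSet (X : Type u) [PartialOrder X] [TopologicalSpace X] : Type u :=
  {U : ClopenUpperSet X // (U : Set X).Nonempty}

/-- `G` is, up to natural isomorphism, the functor `(-)^*` on bRS-spaces: `G X` is the algebra of
nonempty clopen up-sets of `X` ordered by inclusion, with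
`U → V = {x | ↑x ∩ U ⊆ V}` and with constant the complement of `D`, and `G φ` is
`U ↦ φ⁻¹[U]`. -/
def IsDualAlgFunctorBRS (G : BRSSpace.{u}ᵒᵖ ⥤ BRSAlg.{u}) : Prop :=
  ∃ j : ∀ X : BRSSpace.{u}, G.obj (op X) ≃o NonemptyClopenUpperSet X,
    (∀ (X : BRSSpace.{u}) (a b : G.obj (op X)),
      ((j X (a ⇨ b)).1 : Set X) = {x | Set.Ici x ∩ (j X a).1 ⊆ (j X b).1}) ∧
    (∀ X : BRSSpace.{u}, ((j X (G.obj (op X)).f).1 : Set X) = X.Dᶜ) ∧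
    (∀ (X Y : BRSSpace.{u}) (φ : X ⟶ Y) (a : G.obj (op Y)),
      ((j X (BRSAlg.map (G.map φ.op) a)).1 : Set X) =
        BRSSpace.map φ ⁻¹' ((j Y a).1 : Set Y))

/-- `G` is, up to natural isomorphism, the functor `(-)^*` on bG-spaces: `G X` is the algebra of
clopen up-sets of `X` ordered by inclusion, with `U → V = {x | ↑x ∩ U ⊆ V}` and with constant
the complement of `D`, and `G φ` is `U ↦ φ⁻¹[U]`. -/
def IsDualAlgFunctorBG (G : BGSpace.{u}ᵒᵖ ⥤ BGAlg.{u}) : Prop :=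
  ∃ j : ∀ X : BGSpace.{u}, G.obj (op X) ≃o ClopenUpperSet X,
    (∀ (X : BGSpace.{u}) (a b : G.obj (op X)),
      (j X (a ⇨ b) : Set X) = {x | Set.Ici x ∩ (j X a) ⊆ (j X b)}) ∧
    (∀ X : BGSpace.{u}, (j X (G.obj (op X)).f : Set X) = X.Dᶜ) ∧
    (∀ (X Y : BGSpace.{u}) (φ : X ⟶ Y) (a : G.obj (op Y)),
      (j X (BGAlg.map (G.map φ.op) a) : Set X) = BGSpace.map φ ⁻¹' (j Y a : Set Y))

/-! ## Brouwerian algebras -/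

/-! The theorem refines Esakia duality. An element a is represented by the clopen up-set σ(a) of the
filters containing it: the prime filter theorem makes σ an order embedding, and compactness makes
every nonempty clopen up-set of generalized prime filters a σ(a). A point p is represented by the
filter of the clopen up-sets containing it: Priestley separation makes this an order embedding, and
compactness makes it onto. Order isomorphisms preserve the implication, and continuous bijections
from compact to Hausdorff spaces are homeomorphisms, so both representations are isomorphisms of the
full structures. Their naturality is the tautology h(a) ∈ y ↔ a ∈ h⁻¹[y].

Two further conditions have to correspond. Prelinearity, (a → b) ∨ (b → a) = t, makes the space a
forest (`GenPrimeFilter.isForest`). Conversely, in a forest the up-sets cut down to ↑x form a chain,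
and these cuts, for all x, give a subdirect representation by chains (`TraceIci`). The identity a ∨
(a → f) = t forces every filter omitting f to be minimal (`GenPrimeFilter.isMin_of_notMem`), and the
complement of a clopen set of minimal points satisfies that identity
(`ClopenUpperSet.sup_himp_complOfIsMin`).

The improper filter is the greatest point and makes the filter space compact without a least element
in the algebra. If ⊥ exists, the prime filters are the clopen subspace of generalized prime filters
omitting ⊥, so the facts about bG-algebras follow by restriction. -/

/-- Semilinear Brouwerian algebras are prelinear. -/
theorem IsRelativeStone.himp_sup_himp {A : Type u} [GeneralizedHeytingAlgebra A]
    (hA : IsRelativeStone A) (a b : A) : (a ⇨ b) ⊔ (b ⇨ a) = ⊤ := by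
  obtain ⟨ι, C, _, p, htot, -, hinj⟩ := hA
  refine hinj _ _ fun i => ?_
  rw [(p i).map_sup', (p i).map_himp', (p i).map_himp', (p i).map_top']
  rcases htot i ((p i).toFun a) ((p i).toFun b) with h | h
  · rw [himp_eq_top_iff.2 h, top_sup_eq]
  · rw [himp_eq_top_iff.2 h, sup_top_eq]

/-- A Heyting homomorphism as a homomorphism of Brouwerian algebras. -/
def HeytingHom.toBrouwerianHom {A B : Type*} [HeytingAlgebra A] [HeytingAlgebra B]
    (h : HeytingHom A B) : BrouwerianHom A B where
  toLatticeHom := h.toLatticeHom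
  map_himp' := h.map_himp'
  map_top' := map_top h

theorem IsGoedel.isRelativeStone {A : Type u} [HeytingAlgebra A] (hA : IsGoedel A) :
    IsRelativeStone A := by
  obtain ⟨ι, C, hC, p, htot, hsurj, hinj⟩ := hA
  exact ⟨ι, C, fun i => (hC i).toGeneralizedHeytingAlgebra, fun i => (p i).toBrouwerianHom,
    htot, hsurj, hinj⟩

/-! ## Generalized prime filters -/

namespace GenPrimeFilter

section Lattice

variable {A : Type u} [Lattice A]

theorem sup_mem_iff (x : GenPrimeFilter A) {a b : A} : a ⊔ b ∈ x.1 ↔ a ∈ x.1 ∨ b ∈ x.1 := by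
  refine ⟨fun h => ?_, fun h => h.elim (x.1.mem_of_le le_sup_left) (x.1.mem_of_le le_sup_right)⟩
  rcases x.2 with hx | hx
  · by_contra! hab
    -- The complement of a prime filter is an ideal, so it contains an upper bound c of a and b.
    obtain ⟨c, hc, hac, hbc⟩ := hx.compl_ideal.Directed a hab.1 b hab.2
    exact hc (x.1.mem_of_le (sup_le hac hbc) h)
  · exact .inl (SetLike.mem_coe.1 (hx.symm.subset (Set.mem_univ a)))

/-- A nonempty prime filter given by its set of elements, possibly improper. -/
def ofSet (s : Set A) (hne : s.Nonempty) (hup : ∀ {a b}, a ≤ b → a ∈ s → b ∈ s)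
    (hinf : ∀ {a b}, a ∈ s → b ∈ s → a ⊓ b ∈ s) (hsup : ∀ {a b}, a ⊔ b ∈ s → a ∈ s ∨ b ∈ s) :
    GenPrimeFilter A :=
  ⟨(Order.IsPFilter.of_def hne
      (fun a ha b hb => ⟨a ⊓ b, hinf ha hb, inf_le_left, inf_le_right⟩) hup).toPFilter, by
    by_cases h : s = Set.univ
    · exact .inr h
    · refine .inl ⟨⟨fun a b hba ha hb => ha (hup hba hb), Set.nonempty_compl.2 h, ?_⟩⟩
      exact fun a ha b hb => ⟨a ⊔ b, fun hab => (hsup hab).elim ha hb, le_sup_left, le_sup_right⟩⟩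

theorem le_def {x y : GenPrimeFilter A} : x ≤ y ↔ ∀ a, a ∈ x.1 → a ∈ y.1 := Iff.rfl

protected theorem ext {x y : GenPrimeFilter A} (h : ∀ a, a ∈ x.1 ↔ a ∈ y.1) : x = y :=
  Subtype.ext (SetLike.ext h)

theorem isPrime_of_notMem (x : GenPrimeFilter A) {a : A} (ha : a ∉ x.1) : x.1.IsPrime :=
  x.2.resolve_right fun h => ha (SetLike.mem_coe.1 (h.symm.subset (Set.mem_univ a)))

theorem isOpen_sigma (a : A) : IsOpen (sigma a) :=
  TopologicalSpace.isOpen_generateFrom_of_mem (.inl ⟨a, rfl⟩)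

theorem isClopen_sigma (a : A) : IsClopen (sigma a) :=
  ⟨⟨TopologicalSpace.isOpen_generateFrom_of_mem (.inr ⟨a, rfl⟩)⟩, isOpen_sigma a⟩

theorem isUpperSet_sigma (a : A) : IsUpperSet (sigma a) := fun _ _ hxy hx => hxy hx

theorem continuous_iff {X : Type*} [TopologicalSpace X] {φ : X → GenPrimeFilter A} :
    Continuous φ ↔ ∀ a, IsClopen (φ ⁻¹' sigma a) := by
  refine ⟨fun h a => (isClopen_sigma a).preimage h, fun h => continuous_generateFrom_iff.2 ?_⟩
  rintro _ (⟨a, rfl⟩ | ⟨a, rfl⟩)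
  · exact (h a).isOpen
  · exact (h a).compl.isOpen

instance : PriestleySpace (GenPrimeFilter A) where
  priestley {x y} h := by
    rw [le_def] at h
    push Not at h
    obtain ⟨a, hx, hy⟩ := h
    exact ⟨sigma a, isClopen_sigma a, isUpperSet_sigma a, hx, hy⟩

end Lattice

section Compact

variable {A : Type u} [Lattice A] [OrderTop A]

instance : OrderTop (GenPrimeFilter A) where
  top := ofSet Set.univ Set.univ_nonempty (by simp) (by simp) (by simp)
  le_top _ _ _ := Set.mem_univ _

theorem mem_top (a : A) : a ∈ (⊤ : GenPrimeFilter A).1 := Set.mem_univ a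

/-- An ultrafilter 𝒰 converges to {a | σ(a) ∈ 𝒰}, which is prime because 𝒰 is an ultrafilter. Since
the improper filter is a point, properness need not be checked. -/
instance : CompactSpace (GenPrimeFilter A) := by
  rw [← isCompact_univ_iff, isCompact_iff_ultrafilter_le_nhds]
  intro 𝒰 _
  refine ⟨ofSet {a | sigma a ∈ 𝒰} ⟨⊤, ?_⟩ ?_ ?_ ?_, Set.mem_univ _, ?_⟩
  · exact Filter.mem_of_superset Filter.univ_mem fun x _ => x.1.top_mem
  · exact fun hab ha => Filter.mem_of_superset ha fun x hx => x.1.mem_of_le hab hx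
  · exact fun ha hb => Filter.mem_of_superset (Filter.inter_mem ha hb)
      fun x hx => x.1.inf_mem hx.1 hx.2
  · intro a b hab
    rw [Set.mem_ofPred_eq, Set.mem_ofPred_eq, ← Ultrafilter.union_mem_iff]
    exact Filter.mem_of_superset hab fun x hx => x.sup_mem_iff.1 hx
  · rw [TopologicalSpace.nhds_generateFrom]
    simp only [le_iInf_iff, Filter.le_principal_iff]
    rintro _ ⟨hx, ⟨a, rfl⟩ | ⟨a, rfl⟩⟩
    · exact hx
    · exact Ultrafilter.compl_mem_iff_notMem.2 hx

end Compact

/-- The prime filter theorem. -/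
theorem exists_le_disjoint {A : Type u} [DistribLattice A] {F : Order.PFilter A}
    {I : Order.Ideal A} (h : Disjoint (F : Set A) (I : Set A)) :
    ∃ x : GenPrimeFilter A, (∀ a ∈ F, a ∈ x.1) ∧ ∀ a ∈ I, a ∉ x.1 := by
  obtain ⟨J, hJ, hIJ, hFJ⟩ := DistribLattice.prime_ideal_of_disjoint_filter_ideal h
  refine ⟨ofSet (J : Set A)ᶜ (hJ.compl_filter.Nonempty) (fun hab ha hb => ha (J.lower hab hb))
    (fun ha hb hab => (hJ.mem_or_mem hab).elim ha hb) (fun {a b} hab => ?_), fun a ha => ?_,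
    fun a ha => ?_⟩
  · by_contra! hn
    simp only [Set.mem_compl_iff, not_not] at hn
    exact hab (Order.Ideal.sup_mem hn.1 hn.2)
  · exact Set.disjoint_left.1 hFJ ha
  · exact not_not.2 (hIJ ha)

theorem exists_mem_notMem {A : Type u} [DistribLattice A] {a b : A} (h : ¬ a ≤ b) :
    ∃ x : GenPrimeFilter A, a ∈ x.1 ∧ b ∉ x.1 := by
  obtain ⟨x, hx, hx'⟩ := exists_le_disjoint (F := .principal a) (I := .principal b)
    (Set.disjoint_left.2 fun c hac hcb => h (le_trans hac hcb))
  exact ⟨x, hx a le_rfl, hx' b le_rfl⟩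

theorem sigma_subset_sigma {A : Type u} [DistribLattice A] {a b : A} :
    sigma a ⊆ sigma b ↔ a ≤ b := by
  refine ⟨fun h => ?_, fun h x hx => x.1.mem_of_le h hx⟩
  by_contra hab
  obtain ⟨x, hx, hx'⟩ := exists_mem_notMem hab
  exact hx' (h hx)

/-! ### Implication, the Esakia property and the representation of clopen up-sets -/

section GeneralizedHeytingAlgebra

variable {A B : Type u} [GeneralizedHeytingAlgebra A] [GeneralizedHeytingAlgebra B]

theorem mem_of_himp_mem {x : GenPrimeFilter A} {a b : A} (h : a ⇨ b ∈ x.1) (ha : a ∈ x.1) :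
    b ∈ x.1 :=
  x.1.mem_of_le himp_inf_le (x.1.inf_mem h ha)

/-- The filter {c | a → c ∈ x} is generated by x and a. It misses the ideal ↓b exactly because a → b
∉ x, so the prime filter theorem separates the two. -/
theorem exists_le_of_himp_notMem {x : GenPrimeFilter A} {a b : A} (h : a ⇨ b ∉ x.1) :
    ∃ y, x ≤ y ∧ a ∈ y.1 ∧ b ∉ y.1 := by
  have hF : Order.IsPFilter {c | a ⇨ c ∈ x.1} := by
    refine .of_def ⟨a, by simp⟩ (fun c hc d hd => ⟨c ⊓ d, ?_, inf_le_left, inf_le_right⟩) ?_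
    · rw [Set.mem_ofPred_eq, himp_inf_distrib]
      exact x.1.inf_mem hc hd
    · exact fun hcd hc => x.1.mem_of_le (himp_le_himp_left hcd) hc
  obtain ⟨y, hy, hy'⟩ := exists_le_disjoint (F := hF.toPFilter) (I := .principal b)
    (Set.disjoint_left.2 fun c hc hcb => h (x.1.mem_of_le (himp_le_himp_left hcb) hc))
  exact ⟨y, fun c hc => hy c (x.1.mem_of_le le_himp hc),
    hy a (show a ⇨ a ∈ x.1 by simp), hy' b le_rfl⟩

theorem down_sigma_diff_sigma (a b : A) :
    {x | ∃ y ∈ sigma a \ sigma b, x ≤ y} = (sigma (a ⇨ b))ᶜ := by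
  ext x
  refine ⟨fun ⟨y, hy, hxy⟩ hx => hy.2 (mem_of_himp_mem (hxy hx) hy.1), fun hx => ?_⟩
  obtain ⟨y, hxy, ha, hb⟩ := exists_le_of_himp_notMem hx
  exact ⟨y, ⟨ha, hb⟩, hxy⟩

/-- The sets `σ(a) \ σ(b)` form a basis of neighbourhoods of every point except the greatest. -/
theorem exists_sigma_diff_subset {U : Set (GenPrimeFilter A)} (hU : IsOpen U)
    {x : GenPrimeFilter A} (hxU : x ∈ U) {c : A} (hc : c ∉ x.1) :
    ∃ a b, x ∈ sigma a \ sigma b ∧ sigma a \ sigma b ⊆ U := by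
  induction hU with
  | basic s hs =>
    rcases hs with ⟨a, rfl⟩ | ⟨b, rfl⟩
    -- Without a least element σ(a) need not be such a difference; c, lying outside x, is what gets
    -- subtracted.
    · exact ⟨a, c, ⟨hxU, hc⟩, fun _ h => h.1⟩
    · exact ⟨⊤, b, ⟨x.1.top_mem, hxU⟩, fun _ h => h.2⟩
  | univ => exact ⟨⊤, c, ⟨x.1.top_mem, hc⟩, Set.subset_univ _⟩
  | inter s t _ _ ihs iht =>
    obtain ⟨a, b, h, hs⟩ := ihs hxU.1
    obtain ⟨a', b', h', ht⟩ := iht hxU.2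
    refine ⟨a ⊓ a', b ⊔ b', ⟨x.1.inf_mem h.1 h'.1, fun hx => ?_⟩, fun y hy => ?_⟩
    · exact (x.sup_mem_iff.1 hx).elim h.2 h'.2
    · have h1 := Order.PFilter.inf_mem_iff.1 hy.1
      have h2 := fun h => hy.2 (y.sup_mem_iff.2 h)
      exact ⟨hs ⟨h1.1, fun h => h2 (.inl h)⟩, ht ⟨h1.2, fun h => h2 (.inr h)⟩⟩
  | sUnion S _ ih =>
    obtain ⟨s, hs, hxs⟩ := hxU
    obtain ⟨a, b, h, h'⟩ := ih s hs hxs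
    exact ⟨a, b, h, h'.trans (Set.subset_sUnion_of_mem hs)⟩

theorem eq_top_of_forall_mem {x : GenPrimeFilter A} (h : ∀ a, a ∈ x.1) : x = ⊤ :=
  GenPrimeFilter.ext fun a => iff_of_true (h a) (mem_top a)

/-- A clopen set containing the greatest point has the whole space as down-set. Any other is, by
compactness, a finite union of sets σ(a) \ σ(b), whose down-sets are the clopen sets σ(a → b)ᶜ. -/
theorem isEsakiaSpace : IsEsakiaSpace (GenPrimeFilter A) where
  compact := inferInstance
  priestley := inferInstance
  isClopen_down U hU := by
    by_cases htop : ⊤ ∈ U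
    · convert isClopen_univ
      exact Set.eq_univ_of_forall fun x => ⟨⊤, htop, le_top⟩
    · have hbasis : ∀ x ∈ U, ∃ p : A × A, x ∈ sigma p.1 \ sigma p.2 ∧
          sigma p.1 \ sigma p.2 ⊆ U := by
        intro x hx
        have hx' : ∃ c, c ∉ x.1 := by
          by_contra! h
          exact htop (eq_top_of_forall_mem h ▸ hx)
        obtain ⟨c, hc⟩ := hx'
        obtain ⟨a, b, h⟩ := exists_sigma_diff_subset hU.isOpen hx hc
        exact ⟨(a, b), h⟩
      choose! p hp hpU using hbasis
      obtain ⟨t, htU, ht⟩ := hU.isClosed.isCompact.elim_nhds_subcover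
        (fun x => sigma (p x).1 \ sigma (p x).2) fun x hx =>
          ((isClopen_sigma _).diff (isClopen_sigma _)).isOpen.mem_nhds (hp x hx)
      convert t.finite_toSet.isClopen_biUnion
        fun x _ => (isClopen_sigma ((p x).1 ⇨ (p x).2)).compl using 1
      ext y
      simp only [← down_sigma_diff_sigma, Set.mem_iUnion, Set.mem_ofPred_eq]
      constructor
      · rintro ⟨z, hz, hyz⟩
        obtain ⟨x, hxt, hx⟩ := Set.mem_iUnion₂.1 (ht hz)
        exact ⟨x, hxt, z, hx, hyz⟩
      · rintro ⟨x, hxt, z, hz, hyz⟩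
        exact ⟨z, hpU x (htU x hxt) hz, hyz⟩

/-- Take incomparable y, z above x, with a ∈ y \ z and b ∈ z \ y. By primeness x contains a → b or b
→ a, which forces b ∈ y or a ∈ z. -/
theorem isForest (h : ∀ a b : A, (a ⇨ b) ⊔ (b ⇨ a) = ⊤) : IsForest (GenPrimeFilter A) := by
  intro x y hxy z hxz _
  by_contra! hn
  simp only [le_def] at hn
  push Not at hn
  obtain ⟨⟨a, hay, haz⟩, b, hbz, hby⟩ := hn
  have hab : (a ⇨ b) ⊔ (b ⇨ a) ∈ x.1 := h a b ▸ x.1.top_mem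
  rcases x.sup_mem_iff.1 hab with h | h
  · exact hby (mem_of_himp_mem (hxy h) hay)
  · exact haz (mem_of_himp_mem (hxz h) hbz)

/-- If y ≤ x and a ∈ x, then y contains a or a → f; the latter would put f into x. -/
theorem isMin_of_notMem {f : A} (hf : ∀ a : A, a ⊔ (a ⇨ f) = ⊤) {x : GenPrimeFilter A}
    (hx : f ∉ x.1) : IsMin x := by
  intro y hyx a ha
  have h : a ⊔ (a ⇨ f) ∈ y.1 := hf a ▸ y.1.top_mem
  exact (y.sup_mem_iff.1 h).resolve_right fun h => hx (mem_of_himp_mem (hyx h) ha)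

/-- The dual `y ↦ h⁻¹[y]` of a homomorphism `h`. -/
def comap (h : BrouwerianHom A B) : EsakiaHom (GenPrimeFilter B) (GenPrimeFilter A) where
  toFun y := ofSet (h.toFun ⁻¹' y.1) ⟨⊤, Set.mem_preimage.2 (h.map_top'.symm ▸ y.1.top_mem)⟩
    (fun hab ha => y.1.mem_of_le (OrderHomClass.mono h.toLatticeHom hab) ha)
    (fun {a b} ha hb => Set.mem_preimage.2 ((h.map_inf' a b).symm ▸ y.1.inf_mem ha hb))
    (fun {a b} hab => y.sup_mem_iff.1 (h.map_sup' a b ▸ hab))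
  monotone' _ _ hyz _ ha := hyz ha
  continuous_toFun := continuous_iff.2 fun a => isClopen_sigma (h.toFun a)
  exists_map_eq_of_map_le' y z hyz := by
    -- An element outside z is needed for the ideal below to be nonempty; if z is improper, the
    -- improper filter is a preimage.
    by_cases hz : ∃ d, d ∉ z.1
    · obtain ⟨d₀, hd₀⟩ := hz
      have hmono : ∀ {a b : A}, a ≤ b → h.toFun a ≤ h.toFun b :=
        fun hab => OrderHomClass.mono h.toLatticeHom hab
      -- The filter generated by y and h[z], to be separated from the ideal generated by the image
      -- of the complement of z. A prime filter separating them lies above y and has preimage z.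
      have hF : Order.IsPFilter {b | ∃ c ∈ z.1, h.toFun c ⇨ b ∈ y.1} := by
        refine .of_def ⟨⊤, ⊤, z.1.top_mem, by simp⟩ ?_ ?_
        · rintro b ⟨c, hc, hb⟩ b' ⟨c', hc', hb'⟩
          refine ⟨b ⊓ b', ⟨c ⊓ c', z.1.inf_mem hc hc', ?_⟩, inf_le_left, inf_le_right⟩
          rw [himp_inf_distrib]
          exact y.1.inf_mem (y.1.mem_of_le (himp_le_himp_right (hmono inf_le_left)) hb)
            (y.1.mem_of_le (himp_le_himp_right (hmono inf_le_right)) hb')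
        · rintro b b' hbb' ⟨c, hc, hb⟩
          exact ⟨c, hc, y.1.mem_of_le (himp_le_himp_left hbb') hb⟩
      have hI : Order.IsIdeal {b | ∃ d, d ∉ z.1 ∧ b ≤ h.toFun d} := by
        refine ⟨fun b b' hb ⟨d, hd, hbd⟩ => ⟨d, hd, hb.trans hbd⟩, ⟨_, d₀, hd₀, le_rfl⟩, ?_⟩
        rintro b ⟨d, hd, hb⟩ b' ⟨d', hd', hb'⟩
        refine ⟨b ⊔ b', ⟨d ⊔ d', fun hdd => (z.sup_mem_iff.1 hdd).elim hd hd', ?_⟩,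
          le_sup_left, le_sup_right⟩
        exact sup_le (hb.trans (hmono le_sup_left)) (hb'.trans (hmono le_sup_right))
      obtain ⟨w, hw, hw'⟩ := exists_le_disjoint (F := hF.toPFilter) (I := hI.toIdeal) <| by
        refine Set.disjoint_left.2 ?_
        rintro b ⟨c, hc, hb⟩ ⟨d, hd, hbd⟩
        -- A common element would give h(c) → h(d) = h(c → d) ∈ y, hence c → d ∈ z, with c ∈ z and d
        -- ∉ z.
        refine hd (mem_of_himp_mem (a := c) (hyz ?_) hc)
        refine (?_ : h.toFun (c ⇨ d) ∈ y.1)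
        rw [h.map_himp']
        exact y.1.mem_of_le (himp_le_himp_left hbd) hb
      refine ⟨w, fun b hb => hw b ⟨⊤, z.1.top_mem, y.1.mem_of_le le_himp hb⟩,
        GenPrimeFilter.ext fun a => ⟨fun ha => ?_, fun ha => ?_⟩⟩
      · by_contra haz
        exact hw' (h.toFun a) ⟨a, haz, le_rfl⟩ ha
      · exact hw (h.toFun a) ⟨a, ha, by simp⟩
    · push Not at hz
      exact ⟨⊤, le_top, GenPrimeFilter.ext fun a => iff_of_true (mem_top (h.toFun a)) (hz a)⟩

theorem mem_comap {h : BrouwerianHom A B} {y : GenPrimeFilter B} {a : A} :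
    a ∈ (comap h y).1 ↔ h.toFun a ∈ y.1 := Iff.rfl

/-- Every nonempty clopen up-set of generalized prime filters is of the form `σ(a)`. -/
theorem exists_sigma_eq {U : Set (GenPrimeFilter A)} (hU : IsClopen U) (hU' : IsUpperSet U)
    (hne : U.Nonempty) : ∃ a, sigma a = U := by
  -- First use of compactness: one σ(a) contains U and omits y. The second, applied to the
  -- complement of U, intersects finitely many of these.
  have hsep : ∀ y ∉ U, ∃ a, U ⊆ sigma a ∧ a ∉ y.1 := by
    intro y hy
    have hx : ∀ x ∈ U, ∃ a, a ∈ x.1 ∧ a ∉ y.1 := by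
      intro x hx
      by_contra! h
      exact hy (hU' h hx)
    choose! s hs hsy using hx
    obtain ⟨t, htU, ht⟩ := hU.isClosed.isCompact.elim_nhds_subcover
      (fun x => sigma (s x)) fun x hx => (isOpen_sigma _).mem_nhds (hs x hx)
    -- The empty join need not exist; this is where U must be nonempty.
    have htne : t.Nonempty := by
      obtain ⟨x, hx⟩ := hne
      obtain ⟨z, hz, -⟩ := Set.mem_iUnion₂.1 (ht hx)
      exact ⟨z, hz⟩
    refine ⟨t.sup' htne s, fun x hx => ?_, ?_⟩
    · obtain ⟨z, hz, hxz⟩ := Set.mem_iUnion₂.1 (ht hx)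
      exact x.1.mem_of_le (Finset.le_sup' s hz) hxz
    · refine Finset.sup'_induction htne s (p := fun a => a ∉ y.1) ?_ fun z hz => hsy z (htU z hz)
      exact fun a ha b hb hab => (y.sup_mem_iff.1 hab).elim ha hb
  choose! s hs hsy using hsep
  obtain ⟨t, htU, ht⟩ := hU.compl.isClosed.isCompact.elim_nhds_subcover
    (fun y => (sigma (s y))ᶜ) fun y hy => (isClopen_sigma _).compl.isOpen.mem_nhds (hsy y hy)
  refine ⟨t.inf s, Set.Subset.antisymm (fun x hx => ?_) fun x hx => ?_⟩
  · by_contra hxU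
    obtain ⟨z, hz, hxz⟩ := Set.mem_iUnion₂.1 (ht hxU)
    exact hxz (x.1.mem_of_le (Finset.inf_le hz) hx)
  · refine Finset.inf_induction (p := fun a => a ∈ x.1) x.1.top_mem
      (fun a ha b hb => x.1.inf_mem ha hb) fun y hy => hs y (htU y hy) hx

end GeneralizedHeytingAlgebra

end GenPrimeFilter

/-! ## Prime filters -/

namespace PrimeFilter

section Lattice

variable {A : Type u} [Lattice A]

/-- The inclusion of the prime filters into the generalized prime filters. -/
def toGen (x : PrimeFilter A) : GenPrimeFilter A := ⟨x.1, .inl x.2⟩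

@[simp]
theorem mem_toGen {x : PrimeFilter A} {a : A} : a ∈ x.toGen.1 ↔ a ∈ x.1 := Iff.rfl

theorem toGen_le_toGen {x y : PrimeFilter A} : x.toGen ≤ y.toGen ↔ x ≤ y := Iff.rfl

protected theorem ext {x y : PrimeFilter A} (h : ∀ a, a ∈ x.1 ↔ a ∈ y.1) : x = y :=
  Subtype.ext (SetLike.ext h)

theorem toGen_injective : Function.Injective (toGen : PrimeFilter A → GenPrimeFilter A) :=
  fun _ _ h => Subtype.ext (congrArg (fun z => z.1) h)

theorem preimage_toGen_sigma (a : A) : toGen ⁻¹' GenPrimeFilter.sigma a = sigma a := rfl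

theorem isInducing_toGen :
    Topology.IsInducing (toGen : PrimeFilter A → GenPrimeFilter A) where
  eq_induced := by
    refine Eq.trans ?_ induced_generateFrom_eq.symm
    rw [Set.image_union, ← Set.range_comp, ← Set.range_comp]
    rfl

theorem isClopen_sigma (a : A) : IsClopen (sigma a) :=
  (GenPrimeFilter.isClopen_sigma a).preimage isInducing_toGen.continuous

theorem isUpperSet_sigma (a : A) : IsUpperSet (sigma a) := fun _ _ hxy hx => hxy hx

theorem continuous_iff {X : Type*} [TopologicalSpace X] {φ : X → PrimeFilter A} :
    Continuous φ ↔ ∀ a, IsClopen (φ ⁻¹' sigma a) :=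
  isInducing_toGen.continuous_iff.trans GenPrimeFilter.continuous_iff

theorem bot_notMem [OrderBot A] (x : PrimeFilter A) : ⊥ ∉ x.1 := fun h => by
  obtain ⟨a, ha⟩ := x.2.compl_ideal.Nonempty
  exact ha (x.1.mem_of_le bot_le h)

theorem exists_toGen_eq {x : GenPrimeFilter A} {a : A} (ha : a ∉ x.1) :
    ∃ y : PrimeFilter A, y.toGen = x :=
  ⟨⟨x.1, x.isPrime_of_notMem ha⟩, rfl⟩

/-- A generalized prime filter is proper iff it omits ⊥. So the prime filters form a clopen
subspace, which lets compactness and clopen sets pass between the two spaces. -/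
theorem range_toGen [OrderBot A] : Set.range (toGen (A := A)) = (GenPrimeFilter.sigma ⊥)ᶜ := by
  ext x
  refine ⟨?_, exists_toGen_eq⟩
  rintro ⟨y, rfl⟩
  exact y.bot_notMem

theorem isClosedEmbedding_toGen [OrderBot A] :
    Topology.IsClosedEmbedding (toGen : PrimeFilter A → GenPrimeFilter A) :=
  ⟨⟨isInducing_toGen, toGen_injective⟩,
    range_toGen (A := A) ▸ (GenPrimeFilter.isClopen_sigma ⊥).compl.isClosed⟩

theorem isOpenEmbedding_toGen [OrderBot A] :
    Topology.IsOpenEmbedding (toGen : PrimeFilter A → GenPrimeFilter A) :=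
  ⟨⟨isInducing_toGen, toGen_injective⟩,
    range_toGen (A := A) ▸ (GenPrimeFilter.isClopen_sigma ⊥).compl.isOpen⟩

theorem isClopen_image_toGen [OrderBot A] {U : Set (PrimeFilter A)} (hU : IsClopen U) :
    IsClopen (toGen '' U) :=
  ⟨isClosedEmbedding_toGen.isClosedMap _ hU.isClosed,
    isOpenEmbedding_toGen.isOpenMap _ hU.isOpen⟩

end Lattice

section HeytingAlgebra

variable {A B : Type u} [HeytingAlgebra A] [HeytingAlgebra B]

/-- The down-set of U is the trace of the down-set of its image, which is clopen among the
generalized prime filters. -/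
theorem isEsakiaSpace : IsEsakiaSpace (PrimeFilter A) where
  compact := isClosedEmbedding_toGen.compactSpace
  priestley := ⟨fun {x y} h => by
    obtain ⟨U, hU, hU', hx, hy⟩ := PriestleySpace.priestley (mt toGen_le_toGen.1 h)
    exact ⟨_, hU.preimage isInducing_toGen.continuous, fun _ _ hab ha => hU' hab ha, hx, hy⟩⟩
  isClopen_down U hU := by
    convert (GenPrimeFilter.isEsakiaSpace.isClopen_down _ (isClopen_image_toGen hU)).preimage
      isInducing_toGen.continuous using 1
    ext x
    constructor
    · rintro ⟨y, hy, hxy⟩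
      exact ⟨_, ⟨y, hy, rfl⟩, hxy⟩
    · rintro ⟨_, ⟨y, hy, rfl⟩, hxy⟩
      exact ⟨y, hy, hxy⟩

theorem isForest (h : ∀ a b : A, (a ⇨ b) ⊔ (b ⇨ a) = ⊤) : IsForest (PrimeFilter A) :=
  fun x _ hy _ hz hyz => GenPrimeFilter.isForest h x.toGen hy hz (toGen_injective.ne hyz)

theorem isMin_of_notMem {f : A} (hf : ∀ a : A, a ⊔ (a ⇨ f) = ⊤) {x : PrimeFilter A}
    (hx : f ∉ x.1) : IsMin x :=
  fun y hyx => GenPrimeFilter.isMin_of_notMem hf (x := x.toGen) hx (b := y.toGen) hyx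

/-- The dual `y ↦ h⁻¹[y]` of a homomorphism `h`. -/
def comap (h : HeytingHom A B) : EsakiaHom (PrimeFilter B) (PrimeFilter A) where
  toFun y := ⟨(GenPrimeFilter.comap h.toBrouwerianHom y.toGen).1,
    GenPrimeFilter.isPrime_of_notMem _ (a := ⊥) fun hbot =>
      y.bot_notMem (map_bot h ▸ GenPrimeFilter.mem_comap.1 hbot)⟩
  monotone' _ _ hyz _ ha := hyz ha
  continuous_toFun := continuous_iff.2 fun a => isClopen_sigma (h a)
  exists_map_eq_of_map_le' y z hyz := by
    obtain ⟨w, hyw, hw⟩ :=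
      (GenPrimeFilter.comap h.toBrouwerianHom).exists_map_eq_of_map_le'
        (a := y.toGen) (b := z.toGen) hyz
    -- The lift w found among the generalized prime filters is proper, since its preimage z is.
    have hbot : ⊥ ∉ w.1 := fun hbot => z.bot_notMem <| by
      rw [← mem_toGen, ← hw]
      refine GenPrimeFilter.mem_comap.2 ((?_ : h ⊥ ∈ w.1))
      rwa [map_bot h]
    obtain ⟨v, rfl⟩ := exists_toGen_eq hbot
    exact ⟨v, hyw, toGen_injective hw⟩

theorem sigma_bot : sigma (⊥ : A) = ∅ :=
  Set.eq_empty_of_forall_notMem fun x => x.bot_notMem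

theorem sigma_subset_sigma {a b : A} : sigma a ⊆ sigma b ↔ a ≤ b := by
  refine ⟨fun h => ?_, fun h x hx => x.1.mem_of_le h hx⟩
  by_contra hab
  obtain ⟨x, hx, hx'⟩ := GenPrimeFilter.exists_mem_notMem hab
  obtain ⟨y, rfl⟩ := exists_toGen_eq hx'
  exact hx' (h hx)

/-- Every clopen up-set of prime filters is of the form `σ(a)`. -/
theorem exists_sigma_eq {U : Set (PrimeFilter A)} (hU : IsClopen U) (hU' : IsUpperSet U) :
    ∃ a, sigma a = U := by
  -- The set σ(⊥) consists of the improper filter alone. Adding it makes the image of U a nonempty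
  -- up-set.
  have hup : IsUpperSet (toGen '' U ∪ GenPrimeFilter.sigma ⊥) := by
    rintro _ y hxy (⟨x, hx, rfl⟩ | hx)
    · by_cases hy : ⊥ ∈ y.1
      · exact .inr hy
      · obtain ⟨z, rfl⟩ := exists_toGen_eq hy
        exact .inl ⟨z, hU' hxy hx, rfl⟩
    · exact .inr (hxy hx)
  obtain ⟨a, ha⟩ := GenPrimeFilter.exists_sigma_eq
    ((isClopen_image_toGen hU).union (GenPrimeFilter.isClopen_sigma ⊥)) hup
    ⟨⊤, .inr (GenPrimeFilter.mem_top _)⟩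
  refine ⟨a, ?_⟩
  rw [← preimage_toGen_sigma, ha, Set.preimage_union, preimage_toGen_sigma, sigma_bot,
    Set.union_empty, Set.preimage_image_eq _ toGen_injective]

end HeytingAlgebra

end PrimeFilter

/-! ## Algebras of clopen up-sets -/

section ClopenUpperSet

variable {X Y : Type u} [PartialOrder X] [TopologicalSpace X] [PartialOrder Y]
  [TopologicalSpace Y]

/-- The clopen up-set `U → V = {x | ↑x ∩ U ⊆ V}`. -/
def ClopenUpperSet.himp (hX : IsEsakiaSpace X) (U V : ClopenUpperSet X) : ClopenUpperSet X where
  carrier := {x | Set.Ici x ∩ U ⊆ V}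
  isClopen' := by
    -- U → V is the complement of the down-set of U \ V.
    convert (hX.isClopen_down _ (U.isClopen.diff V.isClopen)).compl using 1
    ext x
    refine ⟨fun h ⟨y, hy, hxy⟩ => hy.2 (h ⟨hxy, hy.1⟩), fun h y hy => ?_⟩
    by_contra hV
    exact h ⟨y, ⟨hy.2, hV⟩, hy.1⟩
  upper' _ _ hxy hx _ hz := hx ⟨hxy.trans hz.1, hz.2⟩

theorem ClopenUpperSet.le_himp_iff (hX : IsEsakiaSpace X) (U V W : ClopenUpperSet X) :
    U ≤ V.himp hX W ↔ U ⊓ V ≤ W :=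
  ⟨fun h x hx => h hx.1 ⟨le_refl x, hx.2⟩, fun h _ hx _ hy => h ⟨U.upper hy.1 hx, hy.2⟩⟩

theorem ClopenUpperSet.le_himp (hX : IsEsakiaSpace X) (U V : ClopenUpperSet X) :
    V ≤ U.himp hX V :=
  (ClopenUpperSet.le_himp_iff hX _ _ _).2 inf_le_left

/-- The Heyting algebra of clopen up-sets of an Esakia space. -/
abbrev ClopenUpperSet.heytingAlgebra (hX : IsEsakiaSpace X) :
    HeytingAlgebra (ClopenUpperSet X) where
  himp := ClopenUpperSet.himp hX
  compl U := U.himp hX ⊥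
  le_top _ := le_top
  bot_le _ := bot_le
  le_himp_iff := ClopenUpperSet.le_himp_iff hX
  himp_bot _ := rfl

theorem NonemptyClopenUpperSet.top_mem [OrderTop X] (U : NonemptyClopenUpperSet X) :
    ⊤ ∈ U.1 :=
  let ⟨_, hx⟩ := U.2
  U.1.upper le_top hx

/-- The Brouwerian algebra of nonempty clopen up-sets of an Esakia space with a greatest
element. -/
abbrev NonemptyClopenUpperSet.generalizedHeytingAlgebra [OrderTop X] (hX : IsEsakiaSpace X) :
    GeneralizedHeytingAlgebra (NonemptyClopenUpperSet X) where
  __ := Subtype.lattice (P := fun U : ClopenUpperSet X => (U : Set X).Nonempty)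
    (fun _ _ hU _ => hU.mono Set.subset_union_left)
    (fun U V hU hV => ⟨⊤, NonemptyClopenUpperSet.top_mem ⟨U, hU⟩,
      NonemptyClopenUpperSet.top_mem ⟨V, hV⟩⟩)
  top := ⟨⊤, ⊤, Set.mem_univ _⟩
  le_top U := (le_top : U.1 ≤ ⊤)
  himp U V := ⟨U.1.himp hX V.1, V.2.mono (ClopenUpperSet.le_himp hX U.1 V.1)⟩
  le_himp_iff U V W := ClopenUpperSet.le_himp_iff hX U.1 V.1 W.1

/-- The clopen up-set `Dᶜ`, for a clopen set `D` of minimal elements. -/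
def ClopenUpperSet.complOfIsMin (D : Set X) (hD : IsClopen D) (hmin : ∀ x ∈ D, IsMin x) :
    ClopenUpperSet X where
  carrier := Dᶜ
  isClopen' := hD.compl
  upper' _ _ hxy hx hy := hx ((hmin _ hy).eq_of_le hxy ▸ hy)

/-- If x ∉ U, no y ≥ x in U can lie in D: minimality of y would give y = x. -/
theorem ClopenUpperSet.sup_himp_complOfIsMin (hX : IsEsakiaSpace X) {D : Set X} (hD : IsClopen D)
    (hmin : ∀ x ∈ D, IsMin x) (U : ClopenUpperSet X) :
    U ⊔ U.himp hX (.complOfIsMin D hD hmin) = ⊤ := by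
  refine top_unique fun x _ => ?_
  by_cases hx : x ∈ U
  · exact .inl hx
  · refine .inr fun y hy hyD => hx ?_
    have hxy : x = y := (hmin y hyD).eq_of_le hy.1
    exact hxy ▸ hy.2

/-- The preimage of a clopen up-set. -/
def ClopenUpperSet.comap (φ : EsakiaHom X Y) (U : ClopenUpperSet Y) : ClopenUpperSet X where
  carrier := φ ⁻¹' U
  isClopen' := U.isClopen.preimage φ.continuous_toFun
  upper' _ _ hxy hx := U.upper (φ.monotone' hxy) hx

/-- One inclusion is monotonicity of φ; the other lifts a point above φ(x) to one above x. -/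
theorem ClopenUpperSet.comap_himp (hX : IsEsakiaSpace X) (hY : IsEsakiaSpace Y)
    (φ : EsakiaHom X Y) (U V : ClopenUpperSet Y) :
    (U.himp hY V).comap φ = (U.comap φ).himp hX (V.comap φ) := by
  refine ClopenUpperSet.ext (Set.ext fun x => ⟨fun h y hy => ?_, fun h y hy => ?_⟩)
  · exact h ⟨φ.monotone' hy.1, hy.2⟩
  · obtain ⟨z, hxz, rfl⟩ := φ.exists_map_eq_of_map_le' hy.1
    exact h ⟨hxz, hy.2⟩

end ClopenUpperSet

/-! ## Semilinearity -/

/-- A totally ordered set with a greatest element is a Brouwerian algebra. -/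
noncomputable abbrev LinearOrder.toGeneralizedHeytingAlgebra (C : Type*) [LinearOrder C]
    [OrderTop C] : GeneralizedHeytingAlgebra C where
  himp a b := if a ≤ b then ⊤ else b
  le_himp_iff a b c := by
    split_ifs with h
    · exact iff_of_true le_top (inf_le_of_right_le h)
    · rw [inf_le_iff, or_iff_left h]

section Semilinear

variable {A X : Type u} [PartialOrder X] (e : A → Set X)

/-- The traces on `↑x` of the sets `e a`. -/
def TraceIci (x : X) : Type u := Set.range fun a => e a ∩ Set.Ici x

namespace TraceIci

variable {e}

/-- Two points witnessing incomparability both lie in the chain ↑x, and the larger would belong to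
both up-sets. -/
theorem total (hX : IsForest X) (he : ∀ a, IsUpperSet (e a)) (x : X) (S T : TraceIci e x) :
    S.1 ⊆ T.1 ∨ T.1 ⊆ S.1 := by
  obtain ⟨_, a, rfl⟩ := S
  obtain ⟨_, b, rfl⟩ := T
  by_contra! h
  simp only [Set.not_subset] at h
  obtain ⟨⟨y, hy, hy'⟩, z, hz, hz'⟩ := h
  rcases (hX x).total hy.2 hz.2 with h | h
  · exact hz' ⟨he a h hy.1, hz.2⟩
  · exact hy' ⟨he b h hz.1, hy.2⟩

/-- The traces on `↑x` of up-sets of a forest are totally ordered by inclusion. -/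
noncomputable abbrev linearOrder (hX : IsForest X) (he : ∀ a, IsUpperSet (e a)) (x : X) :
    LinearOrder (TraceIci e x) where
  __ := Subtype.partialOrder (α := Set X) (· ∈ Set.range fun a => e a ∩ Set.Ici x)
  le_total := total hX he x
  toDecidableLE := Classical.decRel _

/-- The trace of `e a` on `↑x`. -/
def mk (e : A → Set X) (x : X) (a : A) : TraceIci e x := ⟨e a ∩ Set.Ici x, a, rfl⟩

theorem mk_surjective (x : X) : Function.Surjective (mk e x) := by
  rintro ⟨_, a, rfl⟩
  exact ⟨a, rfl⟩

/-- Whether x ∈ e a can be read off the trace at x. -/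
theorem mk_jointly_injective (hinj : Function.Injective e) {a b : A}
    (h : ∀ x, mk e x a = mk e x b) : a = b := by
  refine hinj (Set.ext fun x => ?_)
  have := Set.ext_iff.1 (congrArg Subtype.val (h x)) x
  simpa [mk] using this

theorem mk_sup (hX : IsForest X) (he : ∀ a, IsUpperSet (e a)) (x : X) {a b c : A}
    (hc : e c = e a ∪ e b) :
    letI := linearOrder hX he x
    mk e x c = mk e x a ⊔ mk e x b := by
  let _ := linearOrder hX he x
  have hc' : (mk e x c).1 = (mk e x a).1 ∪ (mk e x b).1 := by
    simp only [mk, hc, Set.union_inter_distrib_right]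
  rcases le_total (mk e x a) (mk e x b) with h | h
  · rw [sup_eq_right.2 h]
    exact Subtype.ext (hc'.trans (Set.union_eq_right.2 h))
  · rw [sup_eq_left.2 h]
    exact Subtype.ext (hc'.trans (Set.union_eq_left.2 h))

theorem mk_inf (hX : IsForest X) (he : ∀ a, IsUpperSet (e a)) (x : X) {a b c : A}
    (hc : e c = e a ∩ e b) :
    letI := linearOrder hX he x
    mk e x c = mk e x a ⊓ mk e x b := by
  let _ := linearOrder hX he x
  have hc' : (mk e x c).1 = (mk e x a).1 ∩ (mk e x b).1 := by
    simp only [mk, hc]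
    exact Set.inter_inter_distrib_right _ _ _
  rcases le_total (mk e x a) (mk e x b) with h | h
  · rw [inf_eq_left.2 h]
    exact Subtype.ext (hc'.trans (Set.inter_eq_left.2 h))
  · rw [inf_eq_right.2 h]
    exact Subtype.ext (hc'.trans (Set.inter_eq_right.2 h))

/-- The right side is the implication of a chain with greatest element e t ∩ ↑x. If the trace of e a
is not below that of e b, pick z in the first but not the second. A point y of the trace of e c
cannot be below z, or z would lie in e b; so z ≤ y, whence y ∈ e a and y ∈ e b. -/
theorem mk_himp (hX : IsForest X) (he : ∀ a, IsUpperSet (e a)) (x : X) {a b c t : A}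
    (ht : e t = Set.univ) (hc : e c = {x | Set.Ici x ∩ e a ⊆ e b}) :
    letI := linearOrder hX he x
    mk e x c = if mk e x a ≤ mk e x b then mk e x t else mk e x b := by
  let _ := linearOrder hX he x
  split_ifs with h
  · refine Subtype.ext (Set.ext fun y => ?_)
    simp only [mk, hc, ht, Set.univ_inter]
    exact ⟨fun hy => hy.2, fun hy => ⟨fun z hz => (h ⟨hz.2, hy.trans hz.1⟩).1, hy⟩⟩
  · obtain ⟨z, hz, hz'⟩ := Set.not_subset.1 h
    refine Subtype.ext (Set.ext fun y => ?_)
    simp only [mk, hc]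
    refine ⟨fun hy => ⟨?_, hy.2⟩, fun hy => ⟨fun w hw => he b hw.1 hy.1, hy.2⟩⟩
    rcases (hX x).total hy.2 hz.2 with hyz | hzy
    · exact absurd ⟨hy.1 ⟨hyz, hz.1⟩, hz.2⟩ hz'
    · exact hy.1 ⟨le_refl y, he a hzy hz.1⟩

/-- The trace of the greatest element is the greatest trace. -/
abbrev orderTop (hX : IsForest X) (he : ∀ a, IsUpperSet (e a)) (x : X) {t : A}
    (ht : e t = Set.univ) :
    letI := linearOrder hX he x
    OrderTop (TraceIci e x) :=
  letI := linearOrder hX he x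
  { top := mk e x t
    le_top := by
      rintro ⟨_, a, rfl⟩
      exact Set.inter_subset_inter_left _ (ht ▸ Set.subset_univ _) }

/-- The trace of the least element is the least trace. -/
abbrev orderBot (hX : IsForest X) (he : ∀ a, IsUpperSet (e a)) (x : X) {b : A}
    (hb : e b = ∅) :
    letI := linearOrder hX he x
    OrderBot (TraceIci e x) :=
  letI := linearOrder hX he x
  { bot := mk e x b
    bot_le := by
      rintro ⟨_, a, rfl⟩
      exact Set.inter_subset_inter_left _ (hb ▸ Set.empty_subset _) }

end TraceIci

end Semilinear

/-- A Brouwerian algebra of up-sets of a forest is semilinear. -/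
theorem isRelativeStone_of_isForest {A X : Type u} [PartialOrder X] [GeneralizedHeytingAlgebra A]
    (hX : IsForest X) (e : A → Set X) (hinj : Function.Injective e) (he : ∀ a, IsUpperSet (e a))
    (htop : e ⊤ = Set.univ) (hsup : ∀ a b, e (a ⊔ b) = e a ∪ e b)
    (hinf : ∀ a b, e (a ⊓ b) = e a ∩ e b)
    (himp : ∀ a b, e (a ⇨ b) = {x | Set.Ici x ∩ e a ⊆ e b}) : IsRelativeStone A := by
  let _ (x : X) : LinearOrder (TraceIci e x) := TraceIci.linearOrder hX he x
  let _ (x : X) : OrderTop (TraceIci e x) := TraceIci.orderTop hX he x htop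
  let inst (x : X) : GeneralizedHeytingAlgebra (TraceIci e x) :=
    LinearOrder.toGeneralizedHeytingAlgebra _
  exact ⟨X, TraceIci e, inst, fun x =>
    { toFun := TraceIci.mk e x
      map_sup' := fun a b => TraceIci.mk_sup hX he x (hsup a b)
      map_inf' := fun a b => TraceIci.mk_inf hX he x (hinf a b)
      map_himp' := fun a b => TraceIci.mk_himp hX he x htop (himp a b)
      map_top' := rfl }, TraceIci.total hX he, TraceIci.mk_surjective,
    fun a b => TraceIci.mk_jointly_injective hinj⟩

/-- A Heyting algebra of up-sets of a forest is semilinear. -/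
theorem isGoedel_of_isForest {A X : Type u} [PartialOrder X] [HeytingAlgebra A]
    (hX : IsForest X) (e : A → Set X) (hinj : Function.Injective e) (he : ∀ a, IsUpperSet (e a))
    (htop : e ⊤ = Set.univ) (hbot : e ⊥ = ∅) (hsup : ∀ a b, e (a ⊔ b) = e a ∪ e b)
    (hinf : ∀ a b, e (a ⊓ b) = e a ∩ e b)
    (himp : ∀ a b, e (a ⇨ b) = {x | Set.Ici x ∩ e a ⊆ e b}) : IsGoedel A := by
  let _ (x : X) : LinearOrder (TraceIci e x) := TraceIci.linearOrder hX he x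
  let _ (x : X) : BoundedOrder (TraceIci e x) :=
    { __ := TraceIci.orderTop hX he x htop, __ := TraceIci.orderBot hX he x hbot }
  let inst (x : X) : HeytingAlgebra (TraceIci e x) :=
    (LinearOrder.toBiheytingAlgebra (α := TraceIci e x)).toHeytingAlgebra
  refine ⟨X, TraceIci e, inst, fun x =>
    { toFun := TraceIci.mk e x
      map_sup' := fun a b => TraceIci.mk_sup hX he x (hsup a b)
      map_inf' := fun a b => TraceIci.mk_inf hX he x (hinf a b)
      map_himp' := fun a b => ?_
      map_bot' := rfl }, TraceIci.total hX he, TraceIci.mk_surjective,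
    fun a b => TraceIci.mk_jointly_injective hinj⟩
  exact TraceIci.mk_himp hX he x htop (himp a b)

/-! ## Representation of algebras and spaces -/

/-- The representation `a ↦ σ(a)` of a Brouwerian algebra. -/
noncomputable def GenPrimeFilter.sigmaIso (A : Type u) [GeneralizedHeytingAlgebra A] :
    A ≃o NonemptyClopenUpperSet (GenPrimeFilter A) :=
  RelIso.ofSurjective
    (OrderEmbedding.ofMapLEIff
      (fun a => ⟨⟨⟨sigma a, isClopen_sigma a⟩, isUpperSet_sigma a⟩, ⊤, mem_top a⟩)
      fun _ _ => sigma_subset_sigma)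
    fun U => by
      obtain ⟨a, ha⟩ := exists_sigma_eq U.1.isClopen U.1.upper U.2
      exact ⟨a, Subtype.ext (ClopenUpperSet.ext ha)⟩

/-- The representation `a ↦ σ(a)` of a Heyting algebra. -/
noncomputable def PrimeFilter.sigmaIso (A : Type u) [HeytingAlgebra A] :
    A ≃o ClopenUpperSet (PrimeFilter A) :=
  RelIso.ofSurjective
    (OrderEmbedding.ofMapLEIff (fun a => ⟨⟨sigma a, isClopen_sigma a⟩, isUpperSet_sigma a⟩)
      fun _ _ => sigma_subset_sigma)
    fun U => by
      obtain ⟨a, ha⟩ := exists_sigma_eq U.isClopen U.upper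
      exact ⟨a, ClopenUpperSet.ext ha⟩

/-- A prime filter of a lattice of clopen sets of a compact space is given by a point. -/
theorem GenPrimeFilter.exists_forall_mem_iff {A X : Type u} [Lattice A] [TopologicalSpace X]
    [CompactSpace X] {e : A → Set X} (he : ∀ a, IsClopen (e a)) (hle : ∀ a b, e a ⊆ e b → a ≤ b)
    (hsup : ∀ a b, e (a ⊔ b) = e a ∪ e b) (hinf : ∀ a b, e (a ⊓ b) = e a ∩ e b)
    (x : GenPrimeFilter A) {c : A} (hc : c ∉ x.1) : ∃ p, ∀ a, a ∈ x.1 ↔ p ∈ e a := by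
  -- The required point lies in every e a \ e b with a ∈ x and b ∉ x. These sets are directed
  -- downwards, and nonempty because e a ⊆ e b would give a ≤ b and b ∈ x.
  let ι := {p : A × A // p.1 ∈ x.1 ∧ p.2 ∉ x.1}
  obtain ⟨a₀, ha₀⟩ := x.1.nonempty
  have : Nonempty ι := ⟨(a₀, c), ha₀, hc⟩
  have hcl (i : ι) : IsClosed (e i.1.1 \ e i.1.2) := ((he _).diff (he _)).isClosed
  obtain ⟨p, hp⟩ := IsCompact.nonempty_iInter_of_directed_nonempty_isCompact_isClosed
    (fun i : ι => e i.1.1 \ e i.1.2)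
    (fun i j => ⟨⟨(i.1.1 ⊓ j.1.1, i.1.2 ⊔ j.1.2), x.1.inf_mem i.2.1 j.2.1,
        fun h => (x.sup_mem_iff.1 h).elim i.2.2 j.2.2⟩, by
      simp only [hinf, hsup]
      exact ⟨fun _ h => ⟨h.1.1, fun h' => h.2 (.inl h')⟩,
        fun _ h => ⟨h.1.2, fun h' => h.2 (.inr h')⟩⟩⟩)
    (fun i => Set.sdiff_nonempty.2 fun h => i.2.2 (x.1.mem_of_le (hle _ _ h) i.2.1))
    (fun i => (hcl i).isCompact) hcl
  rw [Set.mem_iInter] at hp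
  refine ⟨p, fun a => ⟨fun ha => (hp ⟨(a, c), ha, hc⟩).1, fun ha => ?_⟩⟩
  by_contra h
  exact (hp ⟨(a₀, a), ha₀, h⟩).2 ha

/-! ### Points of an Esakia space as prime filters -/

section Points

variable {X : Type u} [PartialOrder X] [TopologicalSpace X]

/-- The prime filter of the clopen up-sets that contain a given point. -/
def ClopenUpperSet.pointFilter (hX : IsEsakiaSpace X) (p : X) :
    letI := ClopenUpperSet.heytingAlgebra hX
    PrimeFilter (ClopenUpperSet X) :=
  letI := ClopenUpperSet.heytingAlgebra hX
  let x : GenPrimeFilter (ClopenUpperSet X) := .ofSet {U | p ∈ U} ⟨⊤, Set.mem_univ p⟩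
    (fun hUV hU => hUV hU) (fun hU hV => ⟨hU, hV⟩) (fun hUV => hUV)
  ⟨x.1, x.isPrime_of_notMem (a := ⊥) (Set.notMem_empty p)⟩

/-- The generalized prime filter of the nonempty clopen up-sets that contain a given point. -/
def NonemptyClopenUpperSet.pointFilter [OrderTop X] (hX : IsEsakiaSpace X) (p : X) :
    letI := NonemptyClopenUpperSet.generalizedHeytingAlgebra hX
    GenPrimeFilter (NonemptyClopenUpperSet X) :=
  letI := NonemptyClopenUpperSet.generalizedHeytingAlgebra hX
  .ofSet {U | p ∈ U.1} ⟨⊤, Set.mem_univ p⟩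
    (fun hUV hU => hUV hU) (fun hU hV => ⟨hU, hV⟩) (fun hUV => hUV)

/-- The representation of an Esakia space as a space of prime filters. -/
noncomputable def ClopenUpperSet.pointIso (hX : IsEsakiaSpace X) :
    letI := ClopenUpperSet.heytingAlgebra hX
    X ≃o PrimeFilter (ClopenUpperSet X) :=
  letI := ClopenUpperSet.heytingAlgebra hX
  RelIso.ofSurjective
    (OrderEmbedding.ofMapLEIff (ClopenUpperSet.pointFilter hX) fun p q => by
      refine ⟨fun h => ?_, fun h U hU => U.upper h hU⟩
      by_contra hpq
      have := hX.priestley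
      obtain ⟨U, hU, hU', hp, hq⟩ := exists_isClopen_upper_of_not_le hpq
      exact hq (h (show (⟨⟨U, hU⟩, hU'⟩ : ClopenUpperSet X) ∈
        (ClopenUpperSet.pointFilter hX p).1 from hp)))
    fun x => by
      have := hX.compact
      obtain ⟨p, hp⟩ := GenPrimeFilter.exists_forall_mem_iff
        (e := fun U : ClopenUpperSet X => (U : Set X)) (fun U => U.isClopen) (fun _ _ h => h)
        (fun _ _ => rfl) (fun _ _ => rfl) x.toGen x.bot_notMem
      exact ⟨p, PrimeFilter.ext fun U => (hp U).symm⟩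

/-- The representation of an Esakia space with a greatest element as a space of generalized
prime filters. -/
noncomputable def NonemptyClopenUpperSet.pointIso [OrderTop X] (hX : IsEsakiaSpace X) :
    letI := NonemptyClopenUpperSet.generalizedHeytingAlgebra hX
    X ≃o GenPrimeFilter (NonemptyClopenUpperSet X) :=
  letI := NonemptyClopenUpperSet.generalizedHeytingAlgebra hX
  RelIso.ofSurjective
    (OrderEmbedding.ofMapLEIff (NonemptyClopenUpperSet.pointFilter hX) fun p q => by
      refine ⟨fun h => ?_, fun h U hU => U.1.upper h hU⟩
      by_contra hpq
      have := hX.priestley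
      obtain ⟨U, hU, hU', hp, hq⟩ := exists_isClopen_upper_of_not_le hpq
      exact hq (h (show (⟨⟨⟨U, hU⟩, hU'⟩, p, hp⟩ : NonemptyClopenUpperSet X) ∈
        (NonemptyClopenUpperSet.pointFilter hX p).1 from hp)))
    fun x => by
      have := hX.compact
      by_cases hx : ∃ c, c ∉ x.1
      · obtain ⟨c, hc⟩ := hx
        obtain ⟨p, hp⟩ := GenPrimeFilter.exists_forall_mem_iff
          (e := fun U : NonemptyClopenUpperSet X => (U.1 : Set X)) (fun U => U.1.isClopen)
          (fun _ _ h => h) (fun _ _ => rfl) (fun _ _ => rfl) x hc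
        exact ⟨p, GenPrimeFilter.ext fun U => (hp U).symm⟩
      -- The improper filter comes from the greatest point, which lies in every nonempty up-set.
      · push Not at hx
        exact ⟨⊤, GenPrimeFilter.ext fun U =>
          iff_of_true (NonemptyClopenUpperSet.top_mem U) (hx U)⟩

/-- The preimage of σ(U) is U itself. -/
theorem ClopenUpperSet.continuous_pointIso (hX : IsEsakiaSpace X) :
    Continuous (ClopenUpperSet.pointIso hX) :=
  letI := ClopenUpperSet.heytingAlgebra hX
  PrimeFilter.continuous_iff.2 fun U => U.isClopen

theorem NonemptyClopenUpperSet.continuous_pointIso [OrderTop X] (hX : IsEsakiaSpace X) :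
    Continuous (NonemptyClopenUpperSet.pointIso hX) :=
  letI := NonemptyClopenUpperSet.generalizedHeytingAlgebra hX
  GenPrimeFilter.continuous_iff.2 fun U => U.1.isClopen

end Points

/-- An order isomorphism of Brouwerian algebras as a homomorphism. -/
def OrderIso.toBrouwerianHom {A B : Type*} [GeneralizedHeytingAlgebra A]
    [GeneralizedHeytingAlgebra B] (e : A ≃o B) : BrouwerianHom A B where
  toFun := e
  map_sup' := map_sup e
  map_inf' := map_inf e
  -- The adjunction determines the implication from the order.
  map_himp' a b := eq_of_forall_le_iff fun c => by
    obtain ⟨c, rfl⟩ := e.surjective c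
    rw [le_himp_iff, ← map_inf, e.le_iff_le, e.le_iff_le, le_himp_iff]
  map_top' := map_top e

/-- A continuous order isomorphism of Esakia spaces as an Esakia map. -/
def OrderIso.toEsakiaHom {X Y : Type*} [PartialOrder X] [TopologicalSpace X] [PartialOrder Y]
    [TopologicalSpace Y] (e : X ≃o Y) (he : Continuous e) : EsakiaHom X Y where
  toFun := e
  monotone' := e.monotone
  continuous_toFun := he
  exists_map_eq_of_map_le' _ y h := ⟨e.symm y, e.le_symm_apply.2 h, e.apply_symm_apply y⟩

/-- A continuous bijection from a compact space to a Hausdorff one is a homeomorphism, and Priestley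
spaces are Hausdorff. -/
theorem OrderIso.continuous_symm {X Y : Type*} [PartialOrder X] [TopologicalSpace X]
    [PartialOrder Y] [TopologicalSpace Y] (hX : IsEsakiaSpace X) (hY : IsEsakiaSpace Y)
    (e : X ≃o Y) (he : Continuous e) : Continuous e.symm := by
  have := hX.compact
  have := hY.priestley
  exact Continuous.continuous_symm_of_equiv_compact_to_t2 (f := e.toEquiv) he

/-! ## The duality for bRS-algebras -/

namespace BRSAlg

theorem hom_ext {A B : BRSAlg.{u}} {g h : A ⟶ B} (H : ∀ a, map g a = map h a) : g = h := by
  obtain ⟨⟨⟨⟨g, _⟩, _⟩, _, _⟩, _⟩ := g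
  obtain ⟨⟨⟨⟨h, _⟩, _⟩, _, _⟩, _⟩ := h
  obtain rfl : g = h := funext H
  rfl

/-- The morphism given by an order isomorphism that preserves `f`. -/
def homOfOrderIso {A B : BRSAlg.{u}} (e : A ≃o B) (hf : e A.f = B.f) : A ⟶ B :=
  show Hom A B from ⟨e.toBrouwerianHom, hf⟩

/-- The isomorphism given by an order isomorphism that preserves `f`. -/
def isoOfOrderIso {A B : BRSAlg.{u}} (e : A ≃o B) (hf : e A.f = B.f) : A ≅ B where
  hom := homOfOrderIso e hf
  inv := homOfOrderIso e.symm (e.symm_apply_eq.2 hf.symm)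
  hom_inv_id := hom_ext e.symm_apply_apply
  inv_hom_id := hom_ext e.apply_symm_apply

/-- The bRS-space of generalized prime filters. -/
def dual (A : BRSAlg.{u}) : BRSSpace.{u} where
  carrier := GenPrimeFilter A
  isEsakia := GenPrimeFilter.isEsakiaSpace
  isForest := GenPrimeFilter.isForest A.semilinear.himp_sup_himp
  D := (GenPrimeFilter.sigma A.f)ᶜ
  isClopen_D := (GenPrimeFilter.isClopen_sigma A.f).compl
  isMin_of_mem_D _ hx := GenPrimeFilter.isMin_of_notMem A.sup_himp_f hx
  top_notMem_D h := h (GenPrimeFilter.mem_top A.f)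

/-- The morphism `y ↦ h⁻¹[y]` dual to `h`. -/
def dualMap {A B : BRSAlg.{u}} (h : A ⟶ B) : B.dual ⟶ A.dual :=
  show BRSSpace.Hom B.dual A.dual from
  { toHom := GenPrimeFilter.comap (Hom.toHom h)
    map_top := rfl
    image_D := by
      rintro _ ⟨y, hy, rfl⟩ hf
      refine hy ?_
      rw [← Hom.map_f h]
      exact hf
    image_D_compl := by
      rintro _ ⟨y, hy, rfl⟩
      refine fun hf => hf ?_
      refine (?_ : (Hom.toHom h).toFun A.f ∈ y.1)
      rw [Hom.map_f h]
      exact not_not.1 hy }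

/-- The functor `(-)_*` on bRS-algebras. -/
def dualFunctor : BRSAlg.{u}ᵒᵖ ⥤ BRSSpace.{u} where
  obj A := A.unop.dual
  map h := dualMap h.unop

end BRSAlg

namespace BRSSpace

theorem hom_ext {X Y : BRSSpace.{u}} {φ ψ : X ⟶ Y} (H : ∀ x, map φ x = map ψ x) : φ = ψ :=
  Hom.ext (EsakiaHom.ext H)

/-- The morphism given by a continuous order isomorphism that matches the designated sets. -/
def homOfOrderIso {X Y : BRSSpace.{u}} (e : X ≃o Y) (he : Continuous e)
    (hD : ∀ x, e x ∈ Y.D ↔ x ∈ X.D) : X ⟶ Y :=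
  show Hom X Y from
  { toHom := e.toEsakiaHom he
    map_top := map_top e
    image_D := by
      rintro _ ⟨x, hx, rfl⟩
      exact (hD x).2 hx
    image_D_compl := by
      rintro _ ⟨x, hx, rfl⟩ h
      exact hx ((hD x).1 h) }

/-- The isomorphism given by a continuous order isomorphism that matches the designated sets. -/
def isoOfOrderIso {X Y : BRSSpace.{u}} (e : X ≃o Y) (he : Continuous e)
    (hD : ∀ x, e x ∈ Y.D ↔ x ∈ X.D) : X ≅ Y where
  hom := homOfOrderIso e he hD
  inv := homOfOrderIso e.symm (e.continuous_symm X.isEsakia Y.isEsakia he)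
    fun y => by rw [← hD, e.apply_symm_apply]
  hom_inv_id := hom_ext e.symm_apply_apply
  inv_hom_id := hom_ext e.apply_symm_apply

/-- The bRS-algebra of nonempty clopen up-sets. -/
def dual (X : BRSSpace.{u}) : BRSAlg.{u} where
  carrier := NonemptyClopenUpperSet X
  str := NonemptyClopenUpperSet.generalizedHeytingAlgebra X.isEsakia
  semilinear :=
    letI := NonemptyClopenUpperSet.generalizedHeytingAlgebra X.isEsakia
    isRelativeStone_of_isForest X.isForest (fun U : NonemptyClopenUpperSet X => (U.1 : Set X))
      (SetLike.coe_injective.comp Subtype.val_injective) (fun U => U.1.upper) rfl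
      (fun _ _ => rfl) (fun _ _ => rfl) (fun _ _ => rfl)
  f := ⟨.complOfIsMin X.D X.isClopen_D X.isMin_of_mem_D, ⊤, X.top_notMem_D⟩
  sup_himp_f U := Subtype.ext
    (ClopenUpperSet.sup_himp_complOfIsMin X.isEsakia X.isClopen_D X.isMin_of_mem_D U.1)

/-- The two image conditions together say φ⁻¹[D] = D, which is what makes φ⁻¹ preserve f. -/
theorem map_mem_D_iff {X Y : BRSSpace.{u}} (φ : X ⟶ Y) (x : X) : map φ x ∈ Y.D ↔ x ∈ X.D := by
  refine ⟨fun h => ?_, fun h => Hom.image_D φ ⟨x, h, rfl⟩⟩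
  by_contra hx
  exact Hom.image_D_compl φ ⟨x, hx, rfl⟩ h

/-- The morphism `U ↦ φ⁻¹[U]` dual to `φ`. -/
def dualMap {X Y : BRSSpace.{u}} (φ : X ⟶ Y) : Y.dual ⟶ X.dual :=
  show BRSAlg.Hom Y.dual X.dual from
  { toHom :=
    { toFun := fun (U : NonemptyClopenUpperSet Y) =>
        (⟨U.1.comap (Hom.toHom φ), ⊤,
          show (Hom.toHom φ) ⊤ ∈ U.1 from (Hom.map_top φ).symm ▸ NonemptyClopenUpperSet.top_mem U⟩ :
          NonemptyClopenUpperSet X)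
      map_sup' := fun _ _ => rfl
      map_inf' := fun _ _ => rfl
      map_himp' := fun U V => Subtype.ext
        (ClopenUpperSet.comap_himp X.isEsakia Y.isEsakia (Hom.toHom φ) U.1 V.1)
      map_top' := rfl }
    map_f := Subtype.ext (ClopenUpperSet.ext (Set.ext fun x => (map_mem_D_iff φ x).not)) }

/-- The functor `(-)^*` on bRS-spaces. -/
def dualFunctor : BRSSpace.{u} ⥤ BRSAlg.{u}ᵒᵖ where
  obj X := op X.dual
  map φ := (dualMap φ).op

/-- A bRS-space is isomorphic to its double dual. -/
noncomputable def doubleDualIso (X : BRSSpace.{u}) : X ≅ X.dual.dual :=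
  isoOfOrderIso (NonemptyClopenUpperSet.pointIso X.isEsakia)
    -- The designated filters of the double dual are those omitting Dᶜ, so they come from the points
    -- of D.
    (NonemptyClopenUpperSet.continuous_pointIso X.isEsakia) fun _ => not_not

end BRSSpace

/-- A bRS-algebra is isomorphic to its double dual. -/
noncomputable def BRSAlg.doubleDualIso (A : BRSAlg.{u}) : A ≅ A.dual.dual :=
  isoOfOrderIso (GenPrimeFilter.sigmaIso A)
    (Subtype.ext (ClopenUpperSet.ext (compl_compl (GenPrimeFilter.sigma A.f)).symm))

/-- The dual equivalence of bRS-algebras and bRS-spaces. -/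
noncomputable def brsDuality : BRSAlg.{u}ᵒᵖ ≌ BRSSpace.{u} :=
  .mk BRSAlg.dualFunctor BRSSpace.dualFunctor
    -- Naturality reads h(a) ∈ y ↔ a ∈ h⁻¹[y] here, and p ∈ φ⁻¹[U] ↔ φ(p) ∈ U for spaces; both hold
    -- by definition.
    (NatIso.ofComponents (fun A => (BRSAlg.doubleDualIso A.unop).op) fun _ =>
      Quiver.Hom.unop_inj (BRSAlg.hom_ext fun _ => rfl)).symm
    (NatIso.ofComponents BRSSpace.doubleDualIso fun _ =>
      BRSSpace.hom_ext fun _ => rfl).symm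

theorem isDualSpaceFunctorBRS_brsDuality :
    IsDualSpaceFunctorBRS brsDuality.{u}.functor :=
  ⟨fun _ => OrderIso.refl _, fun _ => IsHomeomorph.id, fun _ => Set.image_id _,
    fun _ _ _ _ => rfl⟩

theorem isDualAlgFunctorBRS_brsDuality :
    IsDualAlgFunctorBRS brsDuality.{u}.inverse.leftOp :=
  ⟨fun _ => OrderIso.refl _, fun _ _ _ => rfl, fun _ => rfl, fun _ _ _ _ => rfl⟩

/-- An order isomorphism of Heyting algebras as a homomorphism. -/
def OrderIso.toHeytingHom {A B : Type*} [HeytingAlgebra A] [HeytingAlgebra B] (e : A ≃o B) :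
    HeytingHom A B where
  __ := e.toBrouwerianHom.toLatticeHom
  map_himp' := e.toBrouwerianHom.map_himp'
  map_bot' := map_bot e

/-! ## The duality for bG-algebras -/

namespace BGAlg

theorem hom_ext {A B : BGAlg.{u}} {g h : A ⟶ B} (H : ∀ a, map g a = map h a) : g = h := by
  obtain ⟨⟨⟨⟨g, _⟩, _⟩, _, _⟩, _⟩ := g
  obtain ⟨⟨⟨⟨h, _⟩, _⟩, _, _⟩, _⟩ := h
  obtain rfl : g = h := funext H
  rfl

/-- The morphism given by an order isomorphism that preserves `f`. -/
def homOfOrderIso {A B : BGAlg.{u}} (e : A ≃o B) (hf : e A.f = B.f) : A ⟶ B :=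
  show Hom A B from ⟨e.toHeytingHom, hf⟩

/-- The isomorphism given by an order isomorphism that preserves `f`. -/
def isoOfOrderIso {A B : BGAlg.{u}} (e : A ≃o B) (hf : e A.f = B.f) : A ≅ B where
  hom := homOfOrderIso e hf
  inv := homOfOrderIso e.symm (e.symm_apply_eq.2 hf.symm)
  hom_inv_id := hom_ext e.symm_apply_apply
  inv_hom_id := hom_ext e.apply_symm_apply

/-- The bG-space of prime filters. -/
def dual (A : BGAlg.{u}) : BGSpace.{u} where
  carrier := PrimeFilter A
  isEsakia := PrimeFilter.isEsakiaSpace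
  isForest := PrimeFilter.isForest A.semilinear.isRelativeStone.himp_sup_himp
  D := (PrimeFilter.sigma A.f)ᶜ
  isClopen_D := (PrimeFilter.isClopen_sigma A.f).compl
  isMin_of_mem_D _ hx := PrimeFilter.isMin_of_notMem A.sup_himp_f hx

/-- The morphism `y ↦ h⁻¹[y]` dual to `h`. -/
def dualMap {A B : BGAlg.{u}} (h : A ⟶ B) : B.dual ⟶ A.dual :=
  show BGSpace.Hom B.dual A.dual from
  { toHom := PrimeFilter.comap (Hom.toHom h)
    image_D := by
      rintro _ ⟨y, hy, rfl⟩ hf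
      refine hy ?_
      rw [← Hom.map_f h]
      exact hf
    image_D_compl := by
      rintro _ ⟨y, hy, rfl⟩
      refine fun hf => hf ?_
      refine (?_ : Hom.toHom h A.f ∈ y.1)
      rw [Hom.map_f h]
      exact not_not.1 hy }

/-- The functor `(-)_*` on bG-algebras. -/
def dualFunctor : BGAlg.{u}ᵒᵖ ⥤ BGSpace.{u} where
  obj A := A.unop.dual
  map h := dualMap h.unop

end BGAlg

namespace BGSpace

theorem hom_ext {X Y : BGSpace.{u}} {φ ψ : X ⟶ Y} (H : ∀ x, map φ x = map ψ x) : φ = ψ :=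
  Hom.ext (EsakiaHom.ext H)

/-- The morphism given by a continuous order isomorphism that matches the designated sets. -/
def homOfOrderIso {X Y : BGSpace.{u}} (e : X ≃o Y) (he : Continuous e)
    (hD : ∀ x, e x ∈ Y.D ↔ x ∈ X.D) : X ⟶ Y :=
  show Hom X Y from
  { toHom := e.toEsakiaHom he
    image_D := by
      rintro _ ⟨x, hx, rfl⟩
      exact (hD x).2 hx
    image_D_compl := by
      rintro _ ⟨x, hx, rfl⟩ h
      exact hx ((hD x).1 h) }

/-- The isomorphism given by a continuous order isomorphism that matches the designated sets. -/
def isoOfOrderIso {X Y : BGSpace.{u}} (e : X ≃o Y) (he : Continuous e)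
    (hD : ∀ x, e x ∈ Y.D ↔ x ∈ X.D) : X ≅ Y where
  hom := homOfOrderIso e he hD
  inv := homOfOrderIso e.symm (e.continuous_symm X.isEsakia Y.isEsakia he)
    fun y => by rw [← hD, e.apply_symm_apply]
  hom_inv_id := hom_ext e.symm_apply_apply
  inv_hom_id := hom_ext e.apply_symm_apply

/-- The bG-algebra of clopen up-sets. -/
def dual (X : BGSpace.{u}) : BGAlg.{u} where
  carrier := ClopenUpperSet X
  str := ClopenUpperSet.heytingAlgebra X.isEsakia
  semilinear :=
    letI := ClopenUpperSet.heytingAlgebra X.isEsakia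
    isGoedel_of_isForest X.isForest (fun U : ClopenUpperSet X => (U : Set X))
      SetLike.coe_injective (fun U => U.upper) rfl rfl
      (fun _ _ => rfl) (fun _ _ => rfl) (fun _ _ => rfl)
  f := .complOfIsMin X.D X.isClopen_D X.isMin_of_mem_D
  sup_himp_f := ClopenUpperSet.sup_himp_complOfIsMin X.isEsakia X.isClopen_D X.isMin_of_mem_D

theorem map_mem_D_iff {X Y : BGSpace.{u}} (φ : X ⟶ Y) (x : X) : map φ x ∈ Y.D ↔ x ∈ X.D := by
  refine ⟨fun h => ?_, fun h => Hom.image_D φ ⟨x, h, rfl⟩⟩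
  by_contra hx
  exact Hom.image_D_compl φ ⟨x, hx, rfl⟩ h

/-- The morphism `U ↦ φ⁻¹[U]` dual to `φ`. -/
def dualMap {X Y : BGSpace.{u}} (φ : X ⟶ Y) : Y.dual ⟶ X.dual :=
  show BGAlg.Hom Y.dual X.dual from
  { toHom :=
    { toFun := fun (U : ClopenUpperSet Y) =>
        (U.comap (Hom.toHom φ) : ClopenUpperSet X)
      map_sup' := fun _ _ => rfl
      map_inf' := fun _ _ => rfl
      map_himp' := ClopenUpperSet.comap_himp X.isEsakia Y.isEsakia (Hom.toHom φ)
      map_bot' := rfl }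
    map_f := ClopenUpperSet.ext (Set.ext fun x => (map_mem_D_iff φ x).not) }

/-- The functor `(-)^*` on bG-spaces. -/
def dualFunctor : BGSpace.{u} ⥤ BGAlg.{u}ᵒᵖ where
  obj X := op X.dual
  map φ := (dualMap φ).op

/-- A bG-space is isomorphic to its double dual. -/
noncomputable def doubleDualIso (X : BGSpace.{u}) : X ≅ X.dual.dual :=
  isoOfOrderIso (ClopenUpperSet.pointIso X.isEsakia)
    (ClopenUpperSet.continuous_pointIso X.isEsakia) fun _ => not_not

end BGSpace

/-- A bG-algebra is isomorphic to its double dual. -/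
noncomputable def BGAlg.doubleDualIso (A : BGAlg.{u}) : A ≅ A.dual.dual :=
  isoOfOrderIso (PrimeFilter.sigmaIso A)
    (ClopenUpperSet.ext (compl_compl (PrimeFilter.sigma A.f)).symm)

/-- The dual equivalence of bG-algebras and bG-spaces. -/
noncomputable def bgDuality : BGAlg.{u}ᵒᵖ ≌ BGSpace.{u} :=
  .mk BGAlg.dualFunctor BGSpace.dualFunctor
    (NatIso.ofComponents (fun A => (BGAlg.doubleDualIso A.unop).op) fun _ =>
      Quiver.Hom.unop_inj (BGAlg.hom_ext fun _ => rfl)).symm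
    (NatIso.ofComponents BGSpace.doubleDualIso fun _ =>
      BGSpace.hom_ext fun _ => rfl).symm

theorem isDualSpaceFunctorBG_bgDuality :
    IsDualSpaceFunctorBG bgDuality.{u}.functor :=
  ⟨fun _ => OrderIso.refl _, fun _ => IsHomeomorph.id, fun _ => Set.image_id _,
    fun _ _ _ _ => rfl⟩

theorem isDualAlgFunctorBG_bgDuality :
    IsDualAlgFunctorBG bgDuality.{u}.inverse.leftOp :=
  ⟨fun _ => OrderIso.refl _, fun _ _ _ => rfl, fun _ => rfl, fun _ _ _ _ => rfl⟩

theorem mainTheorem5 :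
    (∃ e : BRSAlg.{u}ᵒᵖ ≌ BRSSpace.{u},
      IsDualSpaceFunctorBRS e.functor ∧ IsDualAlgFunctorBRS e.inverse.leftOp) ∧
    (∃ e : BGAlg.{u}ᵒᵖ ≌ BGSpace.{u},
      IsDualSpaceFunctorBG e.functor ∧ IsDualAlgFunctorBG e.inverse.leftOp) :=
  ⟨⟨brsDuality, isDualSpaceFunctorBRS_brsDuality, isDualAlgFunctorBRS_brsDuality⟩,
    ⟨bgDuality, isDualSpaceFunctorBG_bgDuality, isDualAlgFunctorBG_bgDuality⟩⟩
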